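/- Let $d\ge 0$, let $\mathcal Y\subset\mathbb R$ be compact, and let $\mathcal H\subset C^2(\mathbb R^d,\mathcal Y)$ be a set of twice continuously differentiable functions $\psi:\mathbb R^d\to\mathbb R$ with values in $\mathcal Y$. Put $\mathcal Z=\mathbb R^d\times\mathcal Y$, let $\ell((x,y),\psi)=(y-\psi(x))^2$ be the quadratic loss, and $C_\ell=\sup_{z\in\mathcal Z,\psi\in\mathcal H}\ell(z,\psi)$. Assume that $\mathcal H$ has finite VC dimension under $\ell$, i.e. the class $\mathcal A$ of the sets $\{z\in\mathcal Z:\ell(z,\psi)>b\}$, $\psi\in\mathcal H$, $0<b<C_\ell$, has finite VC dimension: there are only finitely many $n$ for which $\sup_{z_1,\dots,z_n\in\mathcal Z}\#\{(\mathbf 1\{z_1\in A\},\dots,\mathbf 1\{z_n\in A\}):A\in\mathcal A\}=2^n$. Assume moreover that, for all $i,j=1,\dots,d$, $$\sup_{x\in\mathbb R^d,\ \psi\in\mathcal H}\left|\frac{\partial\psi}{\partial x_i}(x)\right|<\infty\quad\text{and}\quad \sup_{x\in\mathbb R^d,\ \psi\in\mathcal H}\left|\frac{\partial^2\psi}{\partial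 x_i\partial x_j}(x)\right|<\infty .$$ Let $Z_i=(X_i,Y_i)$, $i\ge1$, be i.i.d. $\mathcal Z$-valued random vectors with arbitrary law $\nu$, and $S_n=(Z_1,\dots,Z_n)$. For each $n$ let $\Psi_n:\mathcal Z^n\to\mathcal H$ be a prediction rule, $\psi_n=\Psi_n(S_n)$, and for all $x\in\mathbb R^d$, $y\in\mathcal Y$, $\psi\in\mathcal H$ and $s\in\mathcal Z^n$ let $K_{x,y,\psi,s}$ be a positive semidefinite $d\times d$ matrix. Suppose that with probability one $$\lim_{n\to\infty}\ \sup_{x\in\mathbb R^d,\,y\in\mathcal Y,\,\psi\in\mathcal H}[K_{x,y,\psi,S_n}]_{j,j}=0\qquad\text{for all }j=1,\dots,d.$$ Then the Gaussian bolstering error estimator $$\hat\varepsilon_n^{gbr}=\frac1n\sum_{i=1}^n\int_{\mathbb R^d}\left[\psi_n(x)-Y_i\right]^2\,dN(X_i,K_{X_i,Y_i,\psi_n,S_n})(x),$$ where $N(m,K)$ is the (possibly degenerate) Gaussian measure on $\mathbb R^d$ with mean $m$ and covariance matrix $K$, is consistent: with probability one $|\hat\varepsilon_n^{gbr}-\varepsilon_n|\to0$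 as $n\to\infty$, where $\varepsilon_n=\int_{\mathcal Z}(y-\psi_n(x))^2\,d\nu(x,y)$. -/

import Mathlib

open MeasureTheory ProbabilityTheory Filter Topology
open scoped ENNReal

namespace Bolstering

noncomputable section

/-- The `n`-th shatter coefficient of a class `𝒜` of subsets of `Z`: the largest number of
patterns `(1{z₁ ∈ A}, …, 1{zₙ ∈ A})`, `A ∈ 𝒜`, over all choices of points `z₁, …, zₙ`. -/
def shatterCoeff {Z : Type*} (𝒜 : Set (Set Z)) (n : ℕ) : ℕ∞ :=
  ⨆ z : Fin n → Z, Set.encard {v : Fin n → Prop | ∃ A ∈ 𝒜, v = fun i => z i ∈ A}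

/-- The VC dimension of a class of sets: the greatest `n` whose shatter coefficient is `2 ^ n`
(`⊤` if there are arbitrarily large such `n`). -/
def vcDim {Z : Type*} (𝒜 : Set (Set Z)) : ℕ∞ :=
  ⨆ n ∈ {n : ℕ | shatterCoeff 𝒜 n = 2 ^ n}, (n : ℕ∞)

/-- `C_ℓ = sup ℓ(z, ψ)`, possibly infinite, for a nonnegative loss `ℓ` on `Z × H`. -/
def lossSup {Z H : Type*} (ℓ : Z → H → ℝ) : ℝ≥0∞ :=
  ⨆ (z : Z) (ψ : H), ENNReal.ofReal (ℓ z ψ)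

/-- The class of the sets `{z : ℓ(z, ψ) > b}` for `ψ ∈ H` and `b ∈ (0, C_ℓ)`. -/
def lossLevelSets {Z H : Type*} (ℓ : Z → H → ℝ) : Set (Set Z) :=
  {A | ∃ (ψ : H) (b : ℝ), 0 < b ∧ ENNReal.ofReal b < lossSup ℓ ∧ A = {z | b < ℓ z ψ}}

/-- The VC dimension of a hypothesis space `H` under the loss `ℓ`. -/
def vcDimLoss {Z H : Type*} (ℓ : Z → H → ℝ) : ℕ∞ :=
  vcDim (lossLevelSets ℓ)

/-- The feature space `ℝ^d`. -/
abbrev Feature (d : ℕ) : Type := EuclideanSpace ℝ (Fin d)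

/-- The space `ℝ^d × 𝒴` of the data points `(x, y)`. -/
abbrev DataPoint (d : ℕ) (𝒴 : Set ℝ) : Type := Feature d × 𝒴

/-- The quadratic loss `ℓ((x, y), ψ) = (y - ψ(x))²`. -/
def quadraticLoss {d : ℕ} (𝒴 : Set ℝ) (H : Set (Feature d → ℝ)) (z : DataPoint d 𝒴) (ψ : H) : ℝ :=
  ((z.2 : ℝ) - ψ.1 z.1) ^ 2

/-- The partial derivative `∂f/∂x_i`. -/
def partialDeriv {d : ℕ} (i : Fin d) (f : Feature d → ℝ) (x : Feature d) : ℝ :=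
  fderiv ℝ f x (EuclideanSpace.single i 1)

/-- The error `L(ψ) = ∫ ℓ(z, ψ) dν(z)` of a hypothesis under the quadratic loss. -/
def predictionError {d : ℕ} {𝒴 : Set ℝ} {H : Set (Feature d → ℝ)}
    (ν : Measure (DataPoint d 𝒴)) (ψ : H) : ℝ :=
  ∫ z, quadraticLoss 𝒴 H z ψ ∂ν

/-- A prediction rule: for each sample size `n`, a map from samples to hypotheses. -/
abbrev PredictionRule {d : ℕ} (𝒴 : Set ℝ) (H : Set (Feature d → ℝ)) : Type :=
  (n : ℕ) → (Fin n → DataPoint d 𝒴) → H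

/-- The matrices `K_{x,y,ψ,S}`, indexed by the sample size, the sample `S`, `x`, `y` and `ψ`. -/
abbrev KernelFamily {d : ℕ} (𝒴 : Set ℝ) (H : Set (Feature d → ℝ)) : Type :=
  (n : ℕ) → (Fin n → DataPoint d 𝒴) → Feature d → 𝒴 → H → Matrix (Fin d) (Fin d) ℝ

/-- The Gaussian bolstering error estimator of `ψ` on the sample `S`:
`(1/n) ∑ᵢ ∫ (ψ(x) - yᵢ)² dN(xᵢ, K_{xᵢ,yᵢ,ψ,S})(x)`. -/
def gaussianBolstering {d : ℕ} {𝒴 : Set ℝ} {H : Set (Feature d → ℝ)} (K : KernelFamily 𝒴 H)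
    {n : ℕ} (S : Fin n → DataPoint d 𝒴) (ψ : H) : ℝ :=
  (1 / (n : ℝ)) * ∑ i : Fin n,
    ∫ x, (ψ.1 x - ((S i).2 : ℝ)) ^ 2 ∂(multivariateGaussian (S i).1 (K n S (S i).1 (S i).2 ψ))

/-- The sample `S_n(ω)` made of the first `n` data points. -/
def sample {Ω Z : Type*} (D : ℕ → Ω → Z) (n : ℕ) (ω : Ω) : Fin n → Z :=
  fun i => D i ω

/-- An estimator sequence `est` of the random errors `err` is consistent if
`|est_n - err_n| → 0` with probability one. -/
def IsConsistent {Ω : Type*} [MeasurableSpace Ω] (P : Measure Ω) (est err : ℕ → Ω → ℝ) : Prop :=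
  ∀ᵐ ω ∂P, Tendsto (fun n => |est n ω - err n ω|) atTop (𝓝 0)

end

end Bolstering

namespace Bolstering

open scoped NNReal

/-! The difference splits as (bolstered error − empirical error) + (empirical error − true error),
both taken at `ψ_n`. The first is a smoothing bias: values in the compact `𝒴` and bounded first
derivatives make the squared residuals Lipschitz with a common constant, so a Gaussian kernel moves
each by at most a constant times `√(trace K)`, which tends to 0 uniformly. For the second, the
losses form a uniformly bounded, uniformly Lipschitz class on a separable space, and such a class
obeys a uniform strong law under any `ν`. One almost sure event serves all hypotheses, so `ψ_n` may
depend on the sample in any way, measurable or not. -/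

/-- The strong law of large numbers for a real function of i.i.d. random elements. -/
theorem strong_law_ae_comp {Ω Z : Type*} [MeasurableSpace Ω] [MeasurableSpace Z] {P : Measure Ω}
    {ν : Measure Z} {D : ℕ → Ω → Z} (hlaw : ∀ i, HasLaw (D i) ν P) (hindep : iIndepFun D P)
    {g : Z → ℝ} (hg : Measurable g) (hint : Integrable g ν) :
    ∀ᵐ ω ∂P, Tendsto (fun n : ℕ => (∑ i ∈ Finset.range n, g (D i ω)) / n) atTop
      (𝓝 (∫ z, g z ∂ν)) := by
  have hident (i : ℕ) : IdentDistrib (D i) (D 0) P P :=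
    ⟨(hlaw i).aemeasurable, (hlaw 0).aemeasurable, by rw [(hlaw i).map_eq, (hlaw 0).map_eq]⟩
  have key := strong_law_ae_real (fun i ω => g (D i ω))
    (by
      have : Integrable g (P.map (D 0)) := by rwa [(hlaw 0).map_eq]
      exact this.comp_aemeasurable (hlaw 0).aemeasurable)
    (fun i j hij => (hindep.comp (fun _ => g) fun _ => hg).indepFun hij)
    (fun i => (hident i).comp hg)
  have h0 : ∫ ω, g (D 0 ω) ∂P = ∫ z, g z ∂ν :=
    (hlaw 0).integral_comp hg.aestronglyMeasurable
  simpa only [h0] using key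

/-- The uniform strong law of large numbers over a uniformly bounded and uniformly Lipschitz
class of functions on a separable space. -/
theorem uniform_strong_law_of_lipschitz {Ω Z : Type*} [MeasurableSpace Ω] {P : Measure Ω}
    [IsProbabilityMeasure P] [PseudoMetricSpace Z] [TopologicalSpace.SeparableSpace Z]
    [MeasurableSpace Z] [BorelSpace Z] {ν : Measure Z} {D : ℕ → Ω → Z}
    (hlaw : ∀ i, HasLaw (D i) ν P) (hindep : iIndepFun D P) {F : Set (Z → ℝ)} {L M : ℝ≥0}
    (hL : ∀ f ∈ F, LipschitzWith L f) (hM : ∀ f ∈ F, ∀ z, |f z| ≤ M) :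
    ∀ᵐ ω ∂P, TendstoUniformlyOn
      (fun (n : ℕ) (f : Z → ℝ) => (∑ i ∈ Finset.range n, f (D i ω)) / n)
      (fun f => ∫ z, f z ∂ν) atTop F := by
  have : Nonempty Z := (nonempty_of_isProbabilityMeasure P).map (D 0)
  have : IsProbabilityMeasure ν :=
    (hlaw 0).map_eq ▸ Measure.isProbabilityMeasure_map (hlaw 0).aemeasurable
  -- Quantisation of the space that does not depend on `f`: the nearest of the first `N + 1` points
  -- of a dense sequence.
  let s (N : ℕ) : SimpleFunc Z Z := SimpleFunc.nearestPt (TopologicalSpace.denseSeq Z) N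
  -- Envelope of the quantisation error `|f z - f (s N z)|` over all `f ∈ F`; the truncation at `2 *
  -- M` makes it integrable without moments of `ν`.
  let h (N : ℕ) (z : Z) : ℝ := min (2 * M) (L * dist (s N z) z)
  let cell (N : ℕ) (c : Z) : Z → ℝ := (s N ⁻¹' {c}).indicator 1
  have hs (N : ℕ) : Measurable (s N) := (s N).measurable
  have hdist (N : ℕ) : Measurable fun z => dist (s N z) z := by
    have := UniformSpace.secondCountable_of_separable Z
    exact (hs N).dist measurable_id
  have hh_meas (N : ℕ) : Measurable (h N) :=
    measurable_const.min ((hdist N).const_mul _)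
  have hh_nonneg (N : ℕ) (z : Z) : 0 ≤ h N z := le_min (by positivity) (by positivity)
  have hh_norm (N : ℕ) (z : Z) : ‖h N z‖ ≤ 2 * M := by
    rw [Real.norm_of_nonneg (hh_nonneg N z)]; exact min_le_left _ _
  have hh_int (N : ℕ) : Integrable (h N) ν :=
    .of_bound (hh_meas N).aestronglyMeasurable _ (.of_forall (hh_norm N))
  have hh_lim : Tendsto (fun N => ∫ z, h N z ∂ν) atTop (𝓝 0) := by
    rw [← integral_zero Z ℝ (μ := ν)]
    refine tendsto_integral_of_dominated_convergence (fun _ => 2 * (M : ℝ))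
      (fun N => (hh_meas N).aestronglyMeasurable) (integrable_const _)
      (fun N => .of_forall (hh_norm N)) (.of_forall fun z => ?_)
    have h1 : Tendsto (fun N => dist (s N z) z) atTop (𝓝 0) :=
      tendsto_iff_dist_tendsto_zero.1 (SimpleFunc.tendsto_nearestPt
        (TopologicalSpace.denseRange_denseSeq Z z))
    have h2 := (tendsto_const_nhds (x := 2 * (M : ℝ))).min (h1.const_mul (L : ℝ))
    simpa [h] using h2
  have hcell (N : ℕ) (c : Z) : MeasurableSet (s N ⁻¹' {c}) := (s N).measurableSet_fiber c
  have hcell_meas (N : ℕ) (c : Z) : Measurable (cell N c) :=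
    measurable_one.indicator (hcell N c)
  have hcell_int (N : ℕ) (c : Z) : Integrable (cell N c) ν :=
    (integrable_const (1 : ℝ)).indicator (hcell N c)
  -- Only countably many functions, envelopes and cell indicators, need the strong law, hence a
  -- single null set.
  have hae1 : ∀ᵐ ω ∂P, ∀ N : ℕ, Tendsto
      (fun n : ℕ => (∑ i ∈ Finset.range n, h N (D i ω)) / n) atTop (𝓝 (∫ z, h N z ∂ν)) :=
    ae_all_iff.2 fun N => strong_law_ae_comp hlaw hindep (hh_meas N) (hh_int N)
  have hae2 : ∀ᵐ ω ∂P, ∀ N : ℕ, ∀ c ∈ (s N).range, Tendsto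
      (fun n : ℕ => (∑ i ∈ Finset.range n, cell N c (D i ω)) / n) atTop
        (𝓝 (∫ z, cell N c z ∂ν)) :=
    ae_all_iff.2 fun N => (ae_ball_iff (s N).range.countable_toSet).2 fun c _ =>
      strong_law_ae_comp hlaw hindep (hcell_meas N c) (hcell_int N c)
  filter_upwards [hae1, hae2] with ω hω1 hω2
  rw [Metric.tendstoUniformlyOn_iff]
  intro ε hε
  -- Half of `ε`, since the limiting bound contains `∫ h N` twice: from the empirical and from the
  -- true mean.
  obtain ⟨N, hN⟩ := (hh_lim.eventually_lt_const (half_pos hε)).exists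
  have hlim : Tendsto (fun n : ℕ => (∑ i ∈ Finset.range n, h N (D i ω)) / n + ∫ z, h N z ∂ν
      + M * ∑ c ∈ (s N).range, |(∑ i ∈ Finset.range n, cell N c (D i ω)) / n
        - ∫ z, cell N c z ∂ν|) atTop
      (𝓝 (∫ z, h N z ∂ν + ∫ z, h N z ∂ν + M * ∑ c ∈ (s N).range, 0)) := by
    refine ((hω1 N).add_const _).add (.const_mul _ (tendsto_finsetSum _ fun c hc => ?_))
    simpa using ((hω2 N c hc).sub_const (∫ z, cell N c z ∂ν)).abs
  filter_upwards [hlim.eventually_lt_const (u := ε) (by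
    rw [Finset.sum_const_zero, mul_zero]; linarith)] with n hn f hf
  refine lt_of_le_of_lt ?_ hn
  have hclose (z : Z) : |f z - f (s N z)| ≤ h N z := by
    refine le_min ?_ ?_
    · calc |f z - f (s N z)| ≤ |f z| + |f (s N z)| := abs_sub _ _
        _ ≤ 2 * M := by linarith [hM f hf z, hM f hf (s N z)]
    · rw [dist_comm, ← Real.dist_eq]
      exact (hL f hf).dist_le_mul _ _
  -- The quantised `f` combines finitely many cell indicators with coefficients at most `M`, so its
  -- deviation is controlled uniformly in `f`.
  have hdecomp (z : Z) : f (s N z) = ∑ c ∈ (s N).range, f c * cell N c z := by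
    rw [Finset.sum_eq_single_of_mem (s N z) ((s N).mem_range_self z)]
    · simp [cell]
    · intro c _ hc
      simp [cell, hc.symm]
  have hf_int : Integrable f ν :=
    .of_bound (hL f hf).continuous.measurable.aestronglyMeasurable M
      (.of_forall (hM f hf))
  have hfs_int : Integrable (fun z => f (s N z)) ν := by
    simp_rw [hdecomp]
    exact integrable_finsetSum _ fun c _ => (hcell_int N c).const_mul _
  have e1 : |(∑ i ∈ Finset.range n, f (D i ω)) / n - (∑ i ∈ Finset.range n, f (s N (D i ω))) / n|
      ≤ (∑ i ∈ Finset.range n, h N (D i ω)) / n := by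
    rw [← sub_div, abs_div, Nat.abs_cast, ← Finset.sum_sub_distrib]
    gcongr
    exact (Finset.abs_sum_le_sum_abs _ _).trans (Finset.sum_le_sum fun i _ => hclose _)
  have e2 : |∫ z, f z ∂ν - ∫ z, f (s N z) ∂ν| ≤ ∫ z, h N z ∂ν := by
    rw [← integral_sub hf_int hfs_int]
    rw [← Real.norm_eq_abs]
    exact norm_integral_le_of_norm_le (hh_int N) (.of_forall hclose)
  have e3 : |(∑ i ∈ Finset.range n, f (s N (D i ω))) / n - ∫ z, f (s N z) ∂ν|
      ≤ M * ∑ c ∈ (s N).range, |(∑ i ∈ Finset.range n, cell N c (D i ω)) / n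
        - ∫ z, cell N c z ∂ν| := by
    have : (∑ i ∈ Finset.range n, f (s N (D i ω))) / n - ∫ z, f (s N z) ∂ν
        = ∑ c ∈ (s N).range, f c * ((∑ i ∈ Finset.range n, cell N c (D i ω)) / n
          - ∫ z, cell N c z ∂ν) := by
      simp_rw [hdecomp, mul_sub, Finset.sum_sub_distrib]
      rw [integral_finsetSum _ fun c _ => (hcell_int N c).const_mul _, Finset.sum_comm,
        Finset.sum_div]
      simp_rw [integral_const_mul, ← Finset.mul_sum, mul_div_assoc]
    rw [this, Finset.mul_sum]
    refine (Finset.abs_sum_le_sum_abs _ _).trans (Finset.sum_le_sum fun c _ => ?_)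
    rw [abs_mul]
    gcongr
    exact hM f hf c
  rw [Real.dist_eq, abs_sub_comm]
  rw [abs_le] at *
  constructor <;> linarith [e1.1, e1.2, e2.1, e2.2, e3.1, e3.2]

/-! ### Lipschitz estimates and Gaussian smoothing -/

theorem abs_sq_sub_sq_le {a b R : ℝ} (ha : |a| ≤ R) (hb : |b| ≤ R) :
    |a ^ 2 - b ^ 2| ≤ 2 * R * |a - b| := by
  rw [sq_sub_sq, abs_mul]
  gcongr
  linarith [abs_add_le a b]

/-- A differentiable function with bounded partial derivatives is Lipschitz. -/
theorem lipschitzWith_of_abs_partialDeriv_le {d : ℕ} {f : Feature d → ℝ} {C : Fin d → ℝ≥0}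
    (hf : Differentiable ℝ f) (hC : ∀ i x, |partialDeriv i f x| ≤ C i) :
    LipschitzWith (∑ i, C i) f := by
  refine lipschitzWith_of_nnnorm_fderiv_le hf fun x => ?_
  rw [← NNReal.coe_le_coe, coe_nnnorm]
  refine ContinuousLinearMap.opNorm_le_bound _ (by positivity) fun v => ?_
  have hv : fderiv ℝ f x v = ∑ i, v i * partialDeriv i f x := by
    conv_lhs => rw [← (EuclideanSpace.basisFun (Fin d) ℝ).sum_repr v]
    simp [partialDeriv]
  rw [hv, NNReal.coe_sum, Finset.sum_mul]
  refine (norm_sum_le _ _).trans (Finset.sum_le_sum fun i _ => ?_)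
  rw [norm_mul, mul_comm]
  gcongr
  · exact hC i x
  · exact PiLp.norm_apply_le v i

theorem integral_norm_sub_sq_multivariateGaussian {d : ℕ} (m : Feature d)
    {S : Matrix (Fin d) (Fin d) ℝ} (hS : S.PosSemidef) :
    ∫ x, ‖x - m‖ ^ 2 ∂(multivariateGaussian m S) = S.trace := by
  have hmem : MemLp (fun x : Feature d => x - m) 2 (multivariateGaussian m S) :=
    IsGaussian.memLp_two_id.sub (memLp_const m)
  have hmean (i : Fin d) : ∫ x, x i ∂(multivariateGaussian m S) = m i := by
    have := (EuclideanSpace.proj (𝕜 := ℝ) i).integral_comp_comm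
      (IsGaussian.integrable_id (μ := multivariateGaussian m S))
    simpa using this
  have hvar (i : Fin d) : ∫ x, (x i - m i) ^ 2 ∂(multivariateGaussian m S) = S i i := by
    rw [← variance_eval_multivariateGaussian (μ := m) hS i,
      variance_eq_integral (Measurable.aemeasurable (by fun_prop)), hmean]
  simp_rw [EuclideanSpace.real_norm_sq_eq, PiLp.sub_apply]
  rw [integral_finsetSum, Matrix.trace]
  · simp [hvar]
  · intro i _
    exact ((EuclideanSpace.proj (𝕜 := ℝ) i).comp_memLp' hmem).integrable_sq

/-- Jensen's inequality, in the form that the variance of `‖x - m‖` is nonnegative. -/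
theorem integral_norm_sub_multivariateGaussian_le {d : ℕ} (m : Feature d)
    {S : Matrix (Fin d) (Fin d) ℝ} (hS : S.PosSemidef) :
    ∫ x, ‖x - m‖ ∂(multivariateGaussian m S) ≤ √S.trace := by
  have hmem : MemLp (fun x : Feature d => ‖x - m‖) 2 (multivariateGaussian m S) :=
    (IsGaussian.memLp_two_id.sub (memLp_const m)).norm
  refine Real.le_sqrt_of_sq_le ?_
  have h0 := variance_nonneg (fun x : Feature d => ‖x - m‖) (multivariateGaussian m S)
  rw [variance_eq_sub hmem] at h0
  have h1 := integral_norm_sub_sq_multivariateGaussian m hS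
  simp only [Pi.pow_apply] at h0
  linarith

/-- The bias of smoothing a bounded Lipschitz function by a Gaussian kernel. -/
theorem abs_integral_multivariateGaussian_sub_le {d : ℕ} (m : Feature d)
    {S : Matrix (Fin d) (Fin d) ℝ} (hS : S.PosSemidef) {f : Feature d → ℝ} {L : ℝ≥0} {M : ℝ}
    (hL : LipschitzWith L f) (hM : ∀ x, |f x| ≤ M) :
    |∫ x, f x ∂(multivariateGaussian m S) - f m| ≤ L * √S.trace := by
  have hf : Integrable f (multivariateGaussian m S) :=
    .of_bound hL.continuous.measurable.aestronglyMeasurable M (.of_forall hM)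
  have hnorm : Integrable (fun x : Feature d => ‖x - m‖) (multivariateGaussian m S) :=
    (IsGaussian.integrable_id.sub (integrable_const m)).norm
  calc |∫ x, f x ∂(multivariateGaussian m S) - f m|
      = ‖∫ x, (f x - f m) ∂(multivariateGaussian m S)‖ := by
        rw [integral_sub hf (integrable_const _)]; simp
    _ ≤ ∫ x, L * ‖x - m‖ ∂(multivariateGaussian m S) :=
        norm_integral_le_of_norm_le (hnorm.const_mul _)
          (.of_forall fun x => by simpa [dist_eq_norm] using hL.dist_le_mul x m)
    _ ≤ L * √S.trace := by
        rw [integral_const_mul]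
        gcongr
        exact integral_norm_sub_multivariateGaussian_le m hS

/-- The quadratic loss of a Lipschitz hypothesis is Lipschitz in the data point. -/
theorem lipschitzWith_quadraticLoss {d : ℕ} {𝒴 : Set ℝ} {H : Set (Feature d → ℝ)} {L R : ℝ≥0}
    (h𝒴 : ∀ y ∈ 𝒴, |y| ≤ R) (ψ : H) (hψ : ∀ x, ψ.1 x ∈ 𝒴) (hL : LipschitzWith L ψ.1) :
    LipschitzWith (4 * R * (1 + L)) fun z => quadraticLoss 𝒴 H z ψ := by
  have hres (z : DataPoint d 𝒴) : |(z.2 : ℝ) - ψ.1 z.1| ≤ 2 * R := by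
    linarith [abs_sub (z.2 : ℝ) (ψ.1 z.1), h𝒴 _ z.2.2, h𝒴 _ (hψ z.1)]
  refine LipschitzWith.of_dist_le_mul fun z w => ?_
  have h1 : |(z.2 : ℝ) - w.2| ≤ dist z w := le_max_right (dist z.1 w.1) (dist z.2 w.2)
  have h2 : |ψ.1 z.1 - ψ.1 w.1| ≤ L * dist z w :=
    (hL.dist_le_mul z.1 w.1).trans (by gcongr; exact le_max_left _ _)
  have h3 : |((z.2 : ℝ) - ψ.1 z.1) - (w.2 - ψ.1 w.1)| ≤ (1 + L) * dist z w := by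
    rw [sub_sub_sub_comm]
    linarith [abs_sub ((z.2 : ℝ) - w.2) (ψ.1 z.1 - ψ.1 w.1)]
  calc dist (quadraticLoss 𝒴 H z ψ) (quadraticLoss 𝒴 H w ψ)
      ≤ 2 * (2 * R) * |((z.2 : ℝ) - ψ.1 z.1) - (w.2 - ψ.1 w.1)| :=
        abs_sq_sub_sq_le (hres z) (hres w)
    _ ≤ 2 * (2 * R) * ((1 + L) * dist z w) := by gcongr
    _ = (4 * R * (1 + L) : ℝ≥0) * dist z w := by push_cast; ring

/-- The distance between the bolstered and the empirical error of a Lipschitz hypothesis. -/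
theorem abs_gaussianBolstering_sub_le {d : ℕ} {𝒴 : Set ℝ} {H : Set (Feature d → ℝ)} {L R : ℝ≥0}
    (h𝒴 : ∀ y ∈ 𝒴, |y| ≤ R) (K : KernelFamily 𝒴 H) {n : ℕ} (S : Fin n → DataPoint d 𝒴)
    (hK : ∀ x y ψ, (K n S x y ψ).PosSemidef) (ψ : H) (hψ : ∀ x, ψ.1 x ∈ 𝒴)
    (hL : LipschitzWith L ψ.1) {T : ℝ} (hT : ∀ x y, (K n S x y ψ).trace ≤ T) :
    |gaussianBolstering K S ψ - (∑ i, quadraticLoss 𝒴 H (S i) ψ) / n| ≤ 4 * R * L * √T := by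
  have hterm (i : Fin n) : |∫ x, (ψ.1 x - ((S i).2 : ℝ)) ^ 2
      ∂(multivariateGaussian (S i).1 (K n S (S i).1 (S i).2 ψ)) - quadraticLoss 𝒴 H (S i) ψ|
      ≤ 4 * R * L * √T := by
    have hres (x : Feature d) : |ψ.1 x - ((S i).2 : ℝ)| ≤ 2 * R := by
      linarith [abs_sub (ψ.1 x) ((S i).2 : ℝ), h𝒴 _ (S i).2.2, h𝒴 _ (hψ x)]
    have hlip : LipschitzWith (4 * R * L) fun x => (ψ.1 x - ((S i).2 : ℝ)) ^ 2 := by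
      refine LipschitzWith.of_dist_le_mul fun x w => ?_
      have h1 : |(ψ.1 x - ((S i).2 : ℝ)) - (ψ.1 w - (S i).2)| ≤ L * dist x w := by
        rw [sub_sub_sub_cancel_right]; exact hL.dist_le_mul x w
      calc dist ((ψ.1 x - ((S i).2 : ℝ)) ^ 2) ((ψ.1 w - ((S i).2 : ℝ)) ^ 2)
          ≤ 2 * (2 * R) * |(ψ.1 x - ((S i).2 : ℝ)) - (ψ.1 w - (S i).2)| :=
            abs_sq_sub_sq_le (hres x) (hres w)
        _ ≤ 2 * (2 * R) * (L * dist x w) := by gcongr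
        _ = (4 * R * L : ℝ≥0) * dist x w := by push_cast; ring
    have hbdd (x : Feature d) : |(ψ.1 x - ((S i).2 : ℝ)) ^ 2| ≤ (2 * R : ℝ) ^ 2 := by
      rw [abs_pow]; gcongr; exact hres x
    have hbias := abs_integral_multivariateGaussian_sub_le (S i).1
      (hK (S i).1 (S i).2 ψ) hlip hbdd
    have hloss : quadraticLoss 𝒴 H (S i) ψ = (ψ.1 (S i).1 - ((S i).2 : ℝ)) ^ 2 := by
      rw [quadraticLoss]; ring
    rw [hloss]
    refine hbias.trans ?_
    push_cast
    gcongr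
    exact hT _ _
  have hR : 0 ≤ 4 * R * L * √T := by positivity
  rw [gaussianBolstering, one_div, inv_mul_eq_div, ← sub_div, ← Finset.sum_sub_distrib, abs_div,
    Nat.abs_cast]
  -- This form of the bound also covers `n = 0`, where the quotient is 0.
  refine div_le_of_le_mul₀ (by positivity) hR ?_
  refine (Finset.abs_sum_le_sum_abs _ _).trans ((Finset.sum_le_sum fun i _ => hterm i).trans ?_)
  simp [mul_comm]

end Bolstering

/-! ### Consistency of the estimator -/

theorem proposition9 {Ω : Type*} [MeasurableSpace Ω] (P : Measure Ω) [IsProbabilityMeasure P]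
    {d : ℕ} (𝒴 : Set ℝ) (h𝒴 : IsCompact 𝒴)
    -- the hypothesis space `H ⊂ C²(ℝ^d, 𝒴)`
    (H : Set (Bolstering.Feature d → ℝ))
    (hH : ∀ ψ ∈ H, ContDiff ℝ 2 ψ ∧ ∀ x, ψ x ∈ 𝒴)
    (hVC : Bolstering.vcDimLoss (Bolstering.quadraticLoss 𝒴 H) < ⊤)
    (hderiv : ∀ i : Fin d, ∃ C : ℝ, ∀ ψ ∈ H, ∀ x, |Bolstering.partialDeriv i ψ x| ≤ C)
    (hderiv2 : ∀ i j : Fin d, ∃ C : ℝ, ∀ ψ ∈ H, ∀ x,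
      |Bolstering.partialDeriv i (Bolstering.partialDeriv j ψ) x| ≤ C)
    -- the i.i.d. data with law `ν`
    (ν : Measure (Bolstering.DataPoint d 𝒴)) (D : ℕ → Ω → Bolstering.DataPoint d 𝒴)
    (hlaw : ∀ i, HasLaw (D i) ν P) (hindep : iIndepFun D P)
    -- the prediction rule and the covariance matrices
    (Ψ : Bolstering.PredictionRule 𝒴 H) (K : Bolstering.KernelFamily 𝒴 H)
    (hK : ∀ n S x y ψ, (K n S x y ψ).PosSemidef)
    (hK0 : ∀ᵐ ω ∂P, ∀ j : Fin d,
      Tendsto (fun n => ⨆ (x : Bolstering.Feature d) (y : 𝒴) (ψ : H),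
        ENNReal.ofReal (K n (Bolstering.sample D n ω) x y ψ j j)) atTop (𝓝 0)) :
    Bolstering.IsConsistent P
      (fun n ω => Bolstering.gaussianBolstering K (Bolstering.sample D n ω)
        (Ψ n (Bolstering.sample D n ω)))
      (fun n ω => Bolstering.predictionError ν (Ψ n (Bolstering.sample D n ω))) := by
  open Bolstering NNReal in
  obtain ⟨R₀, hR₀⟩ := h𝒴.isBounded.exists_norm_le
  have hR : ∀ y ∈ 𝒴, |y| ≤ R₀.toNNReal := fun y hy => (hR₀ y hy).trans (Real.le_coe_toNNReal R₀)
  set R : ℝ≥0 := R₀.toNNReal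
  choose C hC using hderiv
  set L : ℝ≥0 := ∑ i, (C i).toNNReal
  have hlip (ψ : H) : LipschitzWith L ψ.1 :=
    lipschitzWith_of_abs_partialDeriv_le ((hH ψ.1 ψ.2).1.differentiable (by norm_num))
      fun i x => (hC i ψ.1 ψ.2 x).trans (Real.le_coe_toNNReal _)
  have hval (ψ : H) (x : Feature d) : ψ.1 x ∈ 𝒴 := (hH ψ.1 ψ.2).2 x
  have hulln := uniform_strong_law_of_lipschitz hlaw hindep
    (F := Set.range fun (ψ : H) z => quadraticLoss 𝒴 H z ψ) (L := 4 * R * (1 + L))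
    (M := (2 * R) ^ 2)
    (by
      rintro _ ⟨ψ, rfl⟩
      exact lipschitzWith_quadraticLoss hR ψ (hval ψ) (hlip ψ))
    (by
      rintro _ ⟨ψ, rfl⟩ z
      have : |(z.2 : ℝ) - ψ.1 z.1| ≤ 2 * R := by
        linarith [abs_sub (z.2 : ℝ) (ψ.1 z.1), hR _ z.2.2, hR _ (hval ψ z.1)]
      push_cast
      rw [quadraticLoss, abs_pow]
      gcongr)
  filter_upwards [hulln, hK0] with ω hω hKω
  set t : ℕ → Fin d → ℝ≥0∞ := fun n j => ⨆ (x : Feature d) (y : 𝒴) (ψ : H),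
    ENNReal.ofReal (K n (sample D n ω) x y ψ j j)
  -- Finiteness is needed before `toReal`, which sends `⊤` to 0.
  have htop : ∀ᶠ n in atTop, ∀ j, t n j < ⊤ :=
    eventually_all.2 fun j => (hKω j).eventually_lt_const ENNReal.zero_lt_top
  have htrace : ∀ᶠ n in atTop, ∀ x y ψ,
      (K n (sample D n ω) x y ψ).trace ≤ ∑ j, (t n j).toReal := by
    filter_upwards [htop] with n hn x y ψ
    refine Finset.sum_le_sum fun j _ => ?_
    refine (ENNReal.ofReal_le_iff_le_toReal (hn j).ne).1 ?_
    exact le_iSup_of_le x (le_iSup_of_le y (le_iSup_of_le ψ le_rfl))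
  have hbias : Tendsto (fun n => 4 * R * L * √(∑ j, (t n j).toReal)) atTop (𝓝 0) := by
    have h1 : Tendsto (fun n => ∑ j, (t n j).toReal) atTop (𝓝 (∑ _j : Fin d, (0 : ℝ))) :=
      tendsto_finsetSum _ fun j _ =>
        (ENNReal.tendsto_toReal ENNReal.zero_ne_top).comp (hKω j)
    have h2 := (h1.sqrt).const_mul (4 * R * L : ℝ)
    simpa using h2
  have hstoch : Tendsto (fun n : ℕ => (∑ i : Fin n, quadraticLoss 𝒴 H (sample D n ω i)
      (Ψ n (sample D n ω))) / n - predictionError ν (Ψ n (sample D n ω))) atTop (𝓝 0) := by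
    rw [Metric.tendsto_nhds]
    intro ε hε
    filter_upwards [Metric.tendstoUniformlyOn_iff.1 hω ε hε] with n hn
    -- Uniformity over the class permits evaluation at the data-dependent hypothesis.
    have := hn _ ⟨Ψ n (sample D n ω), rfl⟩
    rw [dist_comm, Real.dist_eq] at this
    rw [Real.dist_eq, sub_zero]
    rwa [← Fin.sum_univ_eq_sum_range
      (fun i => quadraticLoss 𝒴 H (D i ω) (Ψ n (sample D n ω)))] at this
  refine squeeze_zero' (.of_forall fun _ => abs_nonneg _) ?_
    (by simpa using hbias.add hstoch.abs)
  filter_upwards [htrace] with n hn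
  have h1 := abs_gaussianBolstering_sub_le hR K (sample D n ω) (hK n _)
    (Ψ n (sample D n ω)) (hval _) (hlip _) fun x y => hn x y _
  exact (abs_sub_le _ _ _).trans (add_le_add_left h1 _)
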